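/- Let $n\ge 1$. For a convex body $K\subset\mathbb{R}^n$ (a compact convex set with nonempty interior) containing the origin $o$ in its interior, let $h_K(u)=\max_{x\in K}\langle x,u\rangle$ and $\rho_K(u)=\max\{\lambda\ge 0:\lambda u\in K\}$, $u\in S^{n-1}$, be its support and radial functions, and let $K^\circ=\{x:\langle x,y\rangle\le 1\ \text{for all}\ y\in K\}$ be its polar body. Let $B^n$ be the closed unit ball and let $du$ be the spherical Lebesgue measure on $S^{n-1}$. Let $G:(0,\infty)\times S^{n-1}\to(0,\infty)$ be continuous and such that, for every $u\in S^{n-1}$, the function $t\mapsto G(t,u)$ is strictly increasing and convex on $(0,\infty)$, with $\lim_{t\to 0^+}G(t,u)=0$ and $\lim_{t\to\infty}G(t,u)=\infty$. Assume that there is a real $q\ge n-1$ with $$\inf\big\{t^{-q}G(t,u):\ t\ge 1,\ u\in S^{n-1}\big\}>0 .$$ Put $$\widetilde V_G(K)=\int_{S^{n-1}}G(\rho_K(u),u)\,du,\qquad \widehat V_G(K)=\inf\Big\{\eta>0:\int_{S^{n-1}}G\Big(\frac{\rho_K(u)}{\eta},u\Big)du\le 1\Big\},$$ and let $\widetilde{\mathcal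 B}$ (respectively $\widehat{\mathcal B}$) be the set of convex bodies $Q$ with $o\in\mathrm{int}\,Q$ and $\widetilde V_G(Q^\circ)=\widetilde V_G(B^n)$ (respectively $\widehat V_G(Q^\circ)=\widehat V_G(B^n)$). Let $\varphi:(0,\infty)\to(0,\infty)$ be continuous, strictly increasing and convex with $\lim_{t\to0^+}\varphi(t)=0$, $\varphi(1)=1$ and $\lim_{t\to\infty}\varphi(t)=\infty$. Let $\mu$ and $\mu_i$ $(i\in\mathbb{N})$ be nonzero finite Borel measures on $S^{n-1}$, none of them concentrated on a closed hemisphere, such that $\mu_i\to\mu$ weakly. Then: i) for each measure $\nu\in\{\mu\}\cup\{\mu_i:i\in\mathbb{N}\}$ the problem $\inf\big\{\int_{S^{n-1}}\varphi(h_Q(u))\,d\nu(u): Q\in\widetilde{\mathcal B}\big\}$ has a unique minimizer in $\widetilde{\mathcal B}$; and, if $\widetilde M_i$ and $\widetilde M$ denote the minimizers for $\mu_i$ and $\mu$, then $\widetilde M_i\to\widetilde M$ in the Hausdorff metric as $i\to\infty$; ii) the same holds with $\widehat{\mathcal B}$ in place of $\widetilde{\mathcal B}$: for each such $\nu$ there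 is a unique minimizer in $\widehat{\mathcal B}$, and the minimizers $\widehat M_i$ for $\mu_i$ converge in the Hausdorff metric to the minimizer $\widehat M$ for $\mu$. -/

import Mathlib

open MeasureTheory Set Filter Topology

namespace DualPolar

noncomputable section

/-- Euclidean `n`-space. -/
abbrev Space (n : ℕ) : Type := EuclideanSpace ℝ (Fin n)

/-- The unit sphere of Euclidean `n`-space. -/
abbrev USphere (n : ℕ) : Type := Metric.sphere (0 : Space n) 1

/-- The spherical Lebesgue measure `du`, of total mass `n` times the volume of the unit ball
(the `(n-1)`-dimensional Hausdorff measure in its usual normalization). -/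
def sphericalMeasure (n : ℕ) : Measure (USphere n) :=
  (volume : Measure (Space n)).toSphere

/-- The support function `h_K(u) = max {⟪x, u⟫ : x ∈ K}`. -/
def supportFn {n : ℕ} (K : Set (Space n)) (u : USphere n) : ℝ :=
  sSup ((fun x : Space n => inner ℝ x (u : Space n)) '' K)

/-- The radial function `ρ_K(u) = max {t ≥ 0 : t u ∈ K}`. -/
def radialFn {n : ℕ} (K : Set (Space n)) (u : USphere n) : ℝ :=
  sSup {t : ℝ | 0 ≤ t ∧ t • (u : Space n) ∈ K}

/-- The polar body `K° = {x : ⟪x, y⟫ ≤ 1 for all y ∈ K}`. -/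
def polarBody {n : ℕ} (K : Set (Space n)) : Set (Space n) :=
  {x | ∀ y ∈ K, inner ℝ x y ≤ 1}

/-- The general dual volume `∫ G(ρ_K(u), u) du`. -/
def dualVolume {n : ℕ} (G : ℝ → USphere n → ℝ) (K : Set (Space n)) : ℝ :=
  ∫ u, G (radialFn K u) u ∂(sphericalMeasure n)

/-- The homogeneous general dual volume
`inf {η > 0 : ∫ G(ρ_K(u) / η, u) du ≤ 1}`, for `G` increasing in its first variable. -/
def homDualVolume {n : ℕ} (G : ℝ → USphere n → ℝ) (K : Set (Space n)) : ℝ :=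
  sInf {η : ℝ | 0 < η ∧ ∫ u, G (radialFn K u / η) u ∂(sphericalMeasure n) ≤ 1}

/-- The class `𝓖_I` of continuous functions `G : (0, ∞) × S^{n-1} → (0, ∞)` that are strictly
increasing in `t`, with limits `0` at `0+` and `∞` at `∞`. Only the values of `G` at `t > 0`
matter. -/
structure ClassGI {n : ℕ} (G : ℝ → USphere n → ℝ) : Prop where
  continuousOn : ContinuousOn (fun p : ℝ × USphere n => G p.1 p.2) (Ioi 0 ×ˢ univ)
  pos : ∀ t, 0 < t → ∀ u, 0 < G t u
  strictMonoOn : ∀ u, StrictMonoOn (fun t => G t u) (Ioi 0)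
  tendsto_zero : ∀ u, Tendsto (fun t => G t u) (𝓝[>] 0) (𝓝 0)
  tendsto_atTop : ∀ u, Tendsto (fun t => G t u) atTop atTop

/-- The growth condition with exponent `q`:
`inf {G(t, u) / t ^ q : t ≥ 1, u ∈ S^{n-1}} > 0`. -/
def GrowthCondition {n : ℕ} (G : ℝ → USphere n → ℝ) (q : ℝ) : Prop :=
  0 < sInf {x : ℝ | ∃ (t : ℝ) (u : USphere n), 1 ≤ t ∧ x = G t u / t ^ q}

/-- The class `𝓘` of continuous strictly increasing `φ : (0, ∞) → (0, ∞)` with `φ(0+) = 0`,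
`φ(1) = 1`, `φ(∞) = ∞`. Only the values of `φ` at `t > 0` matter. -/
structure ClassI (φ : ℝ → ℝ) : Prop where
  continuousOn : ContinuousOn φ (Ioi 0)
  pos : ∀ t, 0 < t → 0 < φ t
  strictMonoOn : StrictMonoOn φ (Ioi 0)
  tendsto_zero : Tendsto φ (𝓝[>] 0) (𝓝 0)
  map_one : φ 1 = 1
  tendsto_atTop : Tendsto φ atTop atTop

/-- The convex bodies `Q` with the origin in their interior such that `Q°` has the same general
dual volume as the unit ball. -/
def tildeB {n : ℕ} (G : ℝ → USphere n → ℝ) : Set (ConvexBody (Space n)) :=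
  {Q | (0 : Space n) ∈ interior (Q : Set (Space n)) ∧
    dualVolume G (polarBody (Q : Set (Space n))) = dualVolume G (Metric.closedBall 0 1)}

/-- The convex bodies `Q` with the origin in their interior such that `Q°` has the same
homogeneous general dual volume as the unit ball. -/
def hatB {n : ℕ} (G : ℝ → USphere n → ℝ) : Set (ConvexBody (Space n)) :=
  {Q | (0 : Space n) ∈ interior (Q : Set (Space n)) ∧
    homDualVolume G (polarBody (Q : Set (Space n))) = homDualVolume G (Metric.closedBall 0 1)}

/-- The objective `∫ φ(h_Q(u)) dμ(u)`. -/
def orliczIntegral {n : ℕ} (φ : ℝ → ℝ) (μ : FiniteMeasure (USphere n))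
    (Q : ConvexBody (Space n)) : ℝ :=
  ∫ u, φ (supportFn (Q : Set (Space n)) u) ∂(μ : Measure (USphere n))

/-- `M` solves the problem of minimizing `∫ φ(h_Q) dμ` over `Q ∈ B`. -/
def IsSolution {n : ℕ} (φ : ℝ → ℝ) (μ : FiniteMeasure (USphere n))
    (B : Set (ConvexBody (Space n))) (M : ConvexBody (Space n)) : Prop :=
  M ∈ B ∧ orliczIntegral φ μ M = sInf (orliczIntegral φ μ '' B)

/-- `μ` is not concentrated on any closed hemisphere `{u : ⟪u, v⟫ ≥ 0}`. -/
def NotConcentratedOnHemisphere {n : ℕ} (μ : FiniteMeasure (USphere n)) : Prop :=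
  ∀ v : USphere n,
    (μ : Measure (USphere n)) {u : USphere n | 0 ≤ inner ℝ (u : Space n) (v : Space n)}ᶜ ≠ 0

end

end DualPolar

/-!
Since `ρ_{Q°} = 1 / h_Q`, the first constraint reads `∫ G(1 / h_Q(u), u) du = ∫ G(1, u) du`.

The unit ball is admissible, with objective value `μ(S^{n-1})`. As `φ(t) ≥ t - 1` and `μ` is not
concentrated on a hemisphere, the bodies that are at least as good lie in a common ball, also for
all measures near `μ`. If `h_Q(v)` is small for such a `Q`, then `Q°` contains disjoint balls of a
fixed radius around `2v, 3v, …, (N + 1)v`, with `N` of order `1 / h_Q(v)`. In polar coordinates the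
integral of `1 / ‖x‖` over `Q°` minus the unit ball is at most `∫ ρ_{Q°}^m du`, `m = max(1, n - 1)`,
so the latter exceeds a multiple of the `N`-th harmonic number, and the growth of `G` bounds `N`.
Hence these bodies form a compact set, by Blaschke's selection theorem. This gives existence; it
also gives stability, because every cluster point of the minimizers is a minimizer for the limit
measure.

The functions `t ↦ G(1 / t, u)` are strictly convex. So if there were two minimizers, the polar body
of their midpoint would have too small a dual volume; a proper dilate of the midpoint would then be
admissible, with a strictly smaller objective.

For `a = V̂_G(Bⁿ)`, the condition `V̂_G(Q°) = a` is the first constraint for `(t, u) ↦ G(t / a, u)`.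
-/

namespace DualPolar

noncomputable section

open scoped Pointwise

/-! ### Support functions -/

section SupportFunction

variable {n : ℕ} {K L : ConvexBody (Space n)} {u : USphere n} {x : Space n}

lemma exists_norm_smul_eq (hx : x ≠ 0) : ∃ v : USphere n, ‖x‖ • (v : Space n) = x :=
  ⟨⟨‖x‖⁻¹ • x, by simp [norm_smul, hx]⟩, smul_inv_smul₀ (norm_ne_zero_iff.2 hx) x⟩

lemma inner_le_norm (x : Space n) (u : USphere n) : inner ℝ x u ≤ ‖x‖ := by
  simpa only [norm_eq_of_mem_sphere u, mul_one] using real_inner_le_norm x u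

lemma inner_le_supportFn (hx : x ∈ K) (u : USphere n) : inner ℝ x u ≤ supportFn K u :=
  le_csSup (K.isCompact.image (by fun_prop)).bddAbove (mem_image_of_mem _ hx)

lemma supportFn_le {c : ℝ} (h : ∀ x ∈ K, inner ℝ x u ≤ c) : supportFn K u ≤ c :=
  csSup_le (K.nonempty.image _) (forall_mem_image.2 h)

lemma exists_inner_eq_supportFn (K : ConvexBody (Space n)) (u : USphere n) :
    ∃ x ∈ K, inner ℝ x u = supportFn K u :=
  (K.isCompact.image (by fun_prop)).sSup_mem (K.nonempty.image _)

lemma supportFn_le_of_subset_closedBall {R : ℝ}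
    (hR : (K : Set (Space n)) ⊆ Metric.closedBall 0 R) : supportFn K u ≤ R :=
  supportFn_le fun x hx => (inner_le_norm x u).trans (mem_closedBall_zero_iff.1 (hR hx))

lemma supportFn_add (K L : ConvexBody (Space n)) (u : USphere n) :
    supportFn (K + L : ConvexBody (Space n)) u = supportFn K u + supportFn L u := by
  apply le_antisymm
  · refine supportFn_le fun x hx => ?_
    obtain ⟨y, hy, z, hz, rfl⟩ : x ∈ (K : Set (Space n)) + (L : Set (Space n)) := hx
    rw [inner_add_left]
    exact add_le_add (inner_le_supportFn hy u) (inner_le_supportFn hz u)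
  · obtain ⟨y, hy, hyu⟩ := exists_inner_eq_supportFn K u
    obtain ⟨z, hz, hzu⟩ := exists_inner_eq_supportFn L u
    rw [← hyu, ← hzu, ← inner_add_left]
    exact inner_le_supportFn (K := K + L) (add_mem_add hy hz) u

lemma supportFn_smul {c : ℝ} (hc : 0 ≤ c) (K : ConvexBody (Space n)) (u : USphere n) :
    supportFn (c • K : ConvexBody (Space n)) u = c * supportFn K u := by
  apply le_antisymm
  · refine supportFn_le fun x hx => ?_
    obtain ⟨y, hy, rfl⟩ : x ∈ c • (K : Set (Space n)) := hx
    simp only [real_inner_smul_left]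
    exact mul_le_mul_of_nonneg_left (inner_le_supportFn hy u) hc
  · obtain ⟨y, hy, hyu⟩ := exists_inner_eq_supportFn K u
    rw [← hyu, ← real_inner_smul_left]
    exact inner_le_supportFn (K := c • K) (smul_mem_smul_set hy) u

lemma supportFn_midpoint (K L : ConvexBody (Space n)) (u : USphere n) :
    supportFn ((2⁻¹ : ℝ) • (K + L) : ConvexBody (Space n)) u =
      2⁻¹ * supportFn K u + 2⁻¹ * supportFn L u := by
  rw [supportFn_smul (by norm_num), supportFn_add, mul_add]

lemma lipschitzWith_supportFn_left (u : USphere n) :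
    LipschitzWith 1 fun K : ConvexBody (Space n) => supportFn K u := by
  refine LipschitzWith.of_le_add fun K L => supportFn_le fun x hx => ?_
  obtain ⟨y, hy, hxy⟩ := L.isCompact.exists_infDist_eq_dist L.nonempty x
  calc inner ℝ x u = inner ℝ y u + inner ℝ (x - y) u := by rw [inner_sub_left]; ring
    _ ≤ supportFn L u + dist x y :=
      add_le_add (inner_le_supportFn hy u) ((inner_le_norm _ u).trans_eq (dist_eq_norm x y).symm)
    _ ≤ supportFn L u + dist K L := by
      rw [← hxy]
      gcongr
      exact Metric.infDist_le_hausdorffDist_of_mem hx ConvexBody.hausdorffEDist_ne_top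

lemma continuous_supportFn_right (K : ConvexBody (Space n)) :
    Continuous fun u : USphere n => supportFn K u :=
  K.isCompact.continuous_sSup (f := fun (u : USphere n) (x : Space n) => inner ℝ x u) (by fun_prop)

lemma continuous_supportFn :
    Continuous fun p : ConvexBody (Space n) × USphere n => supportFn p.1 p.2 :=
  continuous_prod_of_continuous_lipschitzWith _ 1 continuous_supportFn_right
    lipschitzWith_supportFn_left

lemma mem_of_forall_inner_le_supportFn (h : ∀ u : USphere n, inner ℝ x u ≤ supportFn K u) :
    x ∈ K := by
  by_contra hx
  obtain ⟨f, c, hf, hc⟩ := geometric_hahn_banach_closed_point K.convex K.isClosed hx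
  obtain ⟨w, rfl⟩ := (InnerProductSpace.toDual ℝ (Space n)).surjective f
  simp only [InnerProductSpace.toDual_apply_apply] at hf hc
  have hw : w ≠ 0 := by
    rintro rfl
    obtain ⟨y, hy⟩ := K.nonempty
    simpa only [inner_zero_left, lt_self_iff_false] using (hf y hy).trans hc
  obtain ⟨v, hv⟩ := exists_norm_smul_eq hw
  obtain ⟨y, hy, hyv⟩ := exists_inner_eq_supportFn K v
  have hxy : inner ℝ w x ≤ inner ℝ w y := by
    rw [← hv, real_inner_smul_left, real_inner_smul_left, real_inner_comm, real_inner_comm y, hyv]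
    exact mul_le_mul_of_nonneg_left (h v) (norm_nonneg w)
  exact ((hf y hy).trans hc).not_ge hxy

lemma eq_of_forall_supportFn_eq (h : ∀ u : USphere n, supportFn K u = supportFn L u) : K = L := by
  ext x
  exact ⟨fun hx => mem_of_forall_inner_le_supportFn fun u => h u ▸ inner_le_supportFn hx u,
    fun hx => mem_of_forall_inner_le_supportFn fun u => h u ▸ inner_le_supportFn hx u⟩

lemma closedBall_subset_iff_forall_le_supportFn {r : ℝ} (hr : 0 ≤ r) :
    Metric.closedBall 0 r ⊆ (K : Set (Space n)) ↔ ∀ u : USphere n, r ≤ supportFn K u := by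
  refine ⟨fun h u => ?_, fun h x hx => mem_of_forall_inner_le_supportFn fun u =>
    (inner_le_norm x u).trans ((mem_closedBall_zero_iff.1 hx).trans (h u))⟩
  have hru : r • (u : Space n) ∈ K :=
    h (by simp [norm_smul, norm_eq_of_mem_sphere u, abs_of_nonneg hr])
  simpa only [real_inner_smul_left, real_inner_self_eq_norm_sq, norm_eq_of_mem_sphere u, one_pow,
    mul_one] using inner_le_supportFn hru u

lemma zero_mem_interior_iff :
    (0 : Space n) ∈ interior (K : Set (Space n)) ↔ ∀ u : USphere n, 0 < supportFn K u := by
  rw [mem_interior_iff_mem_nhds]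
  constructor
  · intro h u
    obtain ⟨r, hr, hrK⟩ := Metric.nhds_basis_closedBall.mem_iff.1 h
    exact hr.trans_le ((closedBall_subset_iff_forall_le_supportFn hr.le).1 hrK u)
  · intro h
    obtain ⟨r, hr, hrK⟩ := isCompact_univ.exists_forall_le'
      (continuous_supportFn_right K).continuousOn fun u _ => h u
    exact mem_of_superset (Metric.closedBall_mem_nhds 0 hr)
      ((closedBall_subset_iff_forall_le_supportFn hr.le).2 fun u => hrK u (mem_univ u))

lemma smul_mem_polarBody_iff {t : ℝ} (ht : 0 ≤ t) :
    t • (u : Space n) ∈ polarBody K ↔ t * supportFn K u ≤ 1 := by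
  simp only [polarBody, mem_ofPred_eq, SetLike.mem_coe, real_inner_smul_left,
    real_inner_comm _ (u : Space n)]
  refine ⟨fun h => ?_, fun h y hy =>
    (mul_le_mul_of_nonneg_left (inner_le_supportFn hy u) ht).trans h⟩
  obtain ⟨y, hy, hyu⟩ := exists_inner_eq_supportFn K u
  exact hyu ▸ h y hy

lemma radialFn_polarBody (h : 0 < supportFn K u) :
    radialFn (polarBody (K : Set (Space n))) u = (supportFn K u)⁻¹ := by
  have hset : {t : ℝ | 0 ≤ t ∧ t • (u : Space n) ∈ polarBody K} = Icc 0 (supportFn K u)⁻¹ := by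
    ext t
    exact and_congr_right fun ht => by
      rw [smul_mem_polarBody_iff ht, ← one_div, le_div_iff₀ h]
  rw [radialFn, hset, csSup_Icc (inv_nonneg.2 h.le)]

lemma radialFn_closedBall (u : USphere n) :
    radialFn (Metric.closedBall (0 : Space n) 1) u = 1 := by
  have hset : {t : ℝ | 0 ≤ t ∧ t • (u : Space n) ∈ Metric.closedBall (0 : Space n) 1} =
      Icc 0 1 := by
    ext t
    exact and_congr_right fun ht => by
      simp [norm_smul, norm_eq_of_mem_sphere u, abs_of_nonneg ht]
  rw [radialFn, hset, csSup_Icc zero_le_one]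

lemma isClosed_polarBody (K : Set (Space n)) : IsClosed (polarBody K) := by
  simp only [polarBody, ofPred_forall]
  exact isClosed_biInter fun y _ => isClosed_le (by fun_prop) continuous_const

/-- The closed unit ball as a convex body, the reference element of the admissible classes. -/
def unitBall (n : ℕ) : ConvexBody (Space n) :=
  ⟨Metric.closedBall 0 1, convex_closedBall 0 1, isCompact_closedBall 0 1, ⟨0, by simp⟩⟩

lemma supportFn_unitBall (u : USphere n) : supportFn (unitBall n) u = 1 :=
  (supportFn_le_of_subset_closedBall subset_rfl).antisymm
    ((closedBall_subset_iff_forall_le_supportFn zero_le_one).1 subset_rfl u)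

end SupportFunction

/-! ### Blaschke's selection theorem -/

section BlaschkeSelection

open TopologicalSpace (NonemptyCompacts)

lemma subset_thickening_of_dist_lt {α : Type*} [MetricSpace α] {s t : NonemptyCompacts α} {ε : ℝ}
    (h : dist s t < ε) : (s : Set α) ⊆ Metric.thickening ε t := fun _ hx =>
  Metric.mem_thickening_iff.2 <| Metric.exists_dist_lt_of_hausdorffDist_lt hx h <|
    Metric.hausdorffEDist_ne_top_of_nonempty_of_bounded s.nonempty t.nonempty
      s.isCompact.isBounded t.isCompact.isBounded

variable {V : Type*} [NormedAddCommGroup V] [NormedSpace ℝ V]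

lemma isClosed_setOf_convex_nonemptyCompacts :
    IsClosed {s : NonemptyCompacts V | Convex ℝ (s : Set V)} := by
  refine isClosed_of_closure_subset fun s hs x hx y hy a b ha hb hab => ?_
  rw [← s.isCompact.isClosed.closure_eq, Metric.mem_closure_iff]
  intro ε hε
  obtain ⟨t, ht, hst⟩ := Metric.mem_closure_iff.1 hs (ε / 2) (half_pos hε)
  have hsub := subset_thickening_of_dist_lt hst
  obtain ⟨z, hz, hxyz⟩ := Metric.mem_thickening_iff.1
    (Convex.thickening ht (ε / 2) (hsub hx) (hsub hy) ha hb hab)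
  obtain ⟨w, hw, hzw⟩ := Metric.mem_thickening_iff.1
    (subset_thickening_of_dist_lt (dist_comm s t ▸ hst) hz)
  exact ⟨w, hw, (dist_triangle _ z w).trans_lt (by linarith)⟩

/-- A convex body, regarded as a point of the hyperspace of nonempty compact sets. -/
def toNonemptyCompacts (K : ConvexBody V) : NonemptyCompacts V :=
  ⟨⟨K, K.isCompact⟩, K.nonempty⟩

lemma isClosedEmbedding_toNonemptyCompacts :
    IsClosedEmbedding (toNonemptyCompacts (V := V)) where
  toIsEmbedding := (Isometry.of_dist_eq (f := toNonemptyCompacts) fun _ _ => rfl).isEmbedding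
  isClosed_range := by
    convert isClosed_setOf_convex_nonemptyCompacts (V := V) using 1
    exact Subset.antisymm (range_subset_iff.2 ConvexBody.convex)
      fun s hs => ⟨⟨s, hs, s.isCompact, s.nonempty⟩, rfl⟩

lemma isCompact_setOf_subset {C : Set V} (hC : IsCompact C) :
    IsCompact {K : ConvexBody V | (K : Set V) ⊆ C} :=
  isClosedEmbedding_toNonemptyCompacts.isCompact_preimage
    (NonemptyCompacts.isCompact_subsets_of_isCompact hC)

end BlaschkeSelection

/-! ### Integrals of continuous functions over compact spaces -/

section Integral

variable {Y : Type*} [TopologicalSpace Y] [CompactSpace Y] [MeasurableSpace Y]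
  [OpensMeasurableSpace Y]

lemma integrable_of_continuous {μ : Measure Y} [IsFiniteMeasureOnCompacts μ] {f : Y → ℝ}
    (hf : Continuous f) : Integrable f μ :=
  hf.integrable_of_hasCompactSupport (.of_compactSpace f)

lemma integral_lt_integral_of_forall_lt {μ : Measure Y} [IsFiniteMeasureOnCompacts μ] (hμ : μ ≠ 0)
    {f g : Y → ℝ} (hf : Continuous f) (hg : Continuous g) (h : ∀ y, f y < g y) :
    ∫ y, f y ∂μ < ∫ y, g y ∂μ := by
  rw [← sub_pos, ← integral_sub (integrable_of_continuous hg) (integrable_of_continuous hf),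
    integral_pos_iff_support_of_nonneg (fun y => (sub_pos.2 (h y)).le)
      (integrable_of_continuous (hg.sub hf)),
    Function.support_eq_univ (fun y => (sub_pos.2 (h y)).ne')]
  exact Measure.measure_univ_pos.2 hμ

lemma integral_lt_integral_of_le_of_lt {μ : Measure Y} [IsFiniteMeasureOnCompacts μ]
    [μ.IsOpenPosMeasure] {f g : Y → ℝ} (hf : Continuous f) (hg : Continuous g) (hle : f ≤ g)
    {y : Y} (hlt : f y < g y) : ∫ y, f y ∂μ < ∫ y, g y ∂μ := by
  rw [← sub_pos, ← integral_sub (integrable_of_continuous hg) (integrable_of_continuous hf)]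
  exact (hg.sub hf).integral_pos_of_hasCompactSupport_nonneg_nonzero (.of_compactSpace _)
    (sub_nonneg.2 hle) (sub_pos.2 hlt).ne'

lemma continuous_integral_pairing :
    Continuous fun p : FiniteMeasure Y × C(Y, ℝ) => ∫ y, p.2 y ∂(p.1 : Measure Y) := by
  rw [continuous_iff_continuousAt]
  rintro ⟨μ₀, f₀⟩
  have hdiff : Tendsto (fun p : FiniteMeasure Y × C(Y, ℝ) => ∫ y, (p.2 - f₀) y ∂(p.1 : Measure Y))
      (𝓝 (μ₀, f₀)) (𝓝 0) := by
    have hbound : Continuous fun p : FiniteMeasure Y × C(Y, ℝ) => ‖p.2 - f₀‖ * (p.1.mass : ℝ) :=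
      (continuous_snd.sub continuous_const).norm.mul
        (NNReal.continuous_coe.comp (FiniteMeasure.continuous_mass.comp continuous_fst))
    refine squeeze_zero_norm (fun p => ?_) (hbound.tendsto' _ 0 (by simp))
    exact norm_integral_le_of_norm_le_const (.of_forall (p.2 - f₀).norm_coe_le_norm)
  have hfixed : Continuous fun p : FiniteMeasure Y × C(Y, ℝ) => ∫ y, f₀ y ∂(p.1 : Measure Y) :=
    (FiniteMeasure.continuous_integral_continuousMap f₀).comp continuous_fst
  have hsum := (hfixed.tendsto (μ₀, f₀)).add hdiff
  rw [add_zero] at hsum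
  refine hsum.congr fun p => ?_
  rw [← integral_add (integrable_of_continuous f₀.continuous)
    (integrable_of_continuous (p.2 - f₀).continuous)]
  simp

lemma continuousOn_integral {X : Type*} [TopologicalSpace X] {s : Set X}
    {μ : X → FiniteMeasure Y} {F : X → Y → ℝ} (hμ : ContinuousOn μ s)
    (hF : ContinuousOn (fun p : X × Y => F p.1 p.2) (s ×ˢ univ)) :
    ContinuousOn (fun x => ∫ y, F x y ∂(μ x : Measure Y)) s := by
  rw [continuousOn_iff_continuous_domRestrict] at hμ ⊢
  have hFs : Continuous fun p : s × Y => F p.1 p.2 :=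
    hF.comp_continuous (f := fun p : s × Y => ((p.1 : X), p.2)) (by fun_prop)
      fun p => ⟨p.1.2, mem_univ _⟩
  exact continuous_integral_pairing.comp
    (hμ.prodMk (ContinuousMap.curry ⟨fun p : s × Y => F p.1 p.2, hFs⟩).continuous)

end Integral

/-! ### The general dual volume of a polar body -/

section Functionals

variable {n : ℕ}

instance : IsFiniteMeasure (sphericalMeasure n) :=
  inferInstanceAs (IsFiniteMeasure (volume : Measure (Space n)).toSphere)

instance : (sphericalMeasure n).IsOpenPosMeasure :=
  inferInstanceAs (volume : Measure (Space n)).toSphere.IsOpenPosMeasure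

/-- The class of convex bodies that contain the origin in their interior, the common domain of the
two functionals of the minimization problem. -/
def bodiesAroundZero (n : ℕ) : Set (ConvexBody (Space n)) :=
  {K | (0 : Space n) ∈ interior (K : Set (Space n))}

variable {G : ℝ → USphere n → ℝ} {φ : ℝ → ℝ} {K L : ConvexBody (Space n)} {u : USphere n}

lemma supportFn_pos (hK : K ∈ bodiesAroundZero n) (u : USphere n) : 0 < supportFn K u :=
  zero_mem_interior_iff.1 hK u

lemma smul_mem_bodiesAroundZero {c : ℝ} (hc : 0 < c) (hK : K ∈ bodiesAroundZero n) :
    c • K ∈ bodiesAroundZero n :=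
  zero_mem_interior_iff.2 fun u => by
    rw [supportFn_smul hc.le]
    exact mul_pos hc (supportFn_pos hK u)

lemma midpoint_mem_bodiesAroundZero (hK : K ∈ bodiesAroundZero n) (hL : L ∈ bodiesAroundZero n) :
    (2⁻¹ : ℝ) • (K + L) ∈ bodiesAroundZero n :=
  zero_mem_interior_iff.2 fun u => by
    rw [supportFn_midpoint]
    linarith [supportFn_pos hK u, supportFn_pos hL u]

lemma ClassI.continuous_comp_supportFn (hφ : ClassI φ) (hK : K ∈ bodiesAroundZero n) :
    Continuous fun u : USphere n => φ (supportFn K u) :=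
  hφ.continuousOn.comp_continuous (continuous_supportFn_right K) (supportFn_pos hK)

lemma ClassI.continuousOn_orliczIntegral (hφ : ClassI φ) :
    ContinuousOn (fun p : FiniteMeasure (USphere n) × ConvexBody (Space n) =>
      orliczIntegral φ p.1 p.2) (univ ×ˢ bodiesAroundZero n) := by
  have hsupp : Continuous fun q : (FiniteMeasure (USphere n) × ConvexBody (Space n)) × USphere n =>
      supportFn q.1.2 q.2 :=
    continuous_supportFn.comp (continuous_fst.snd.prodMk continuous_snd)
  exact continuousOn_integral continuousOn_fst <|
    hφ.continuousOn.comp hsupp.continuousOn fun q hq => supportFn_pos hq.1.2 q.2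

lemma ClassGI.continuous_comp (hG : ClassGI G) {f : USphere n → ℝ} (hf : Continuous f)
    (hpos : ∀ u, 0 < f u) : Continuous fun u => G (f u) u :=
  hG.continuousOn.comp_continuous (hf.prodMk continuous_id) fun u => ⟨hpos u, mem_univ u⟩

lemma ClassGI.continuousOn_integral (hG : ClassGI G) {X : Type*} [TopologicalSpace X] {s : Set X}
    {f : X → USphere n → ℝ} (hf : ContinuousOn (fun p : X × USphere n => f p.1 p.2) (s ×ˢ univ))
    (hpos : ∀ x ∈ s, ∀ u, 0 < f x u) :
    ContinuousOn (fun x => ∫ u, G (f x u) u ∂(sphericalMeasure n)) s :=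
  DualPolar.continuousOn_integral (μ := fun _ => ⟨sphericalMeasure n, inferInstance⟩)
    continuousOn_const <|
    hG.continuousOn.comp (hf.prodMk continuousOn_snd) fun p hp => ⟨hpos p.1 hp.1 p.2, mem_univ _⟩

lemma dualVolume_closedBall (G : ℝ → USphere n → ℝ) :
    dualVolume G (Metric.closedBall 0 1) = ∫ u, G 1 u ∂(sphericalMeasure n) := by
  simp only [dualVolume, radialFn_closedBall]

lemma dualVolume_polarBody (G : ℝ → USphere n → ℝ) (hK : K ∈ bodiesAroundZero n) :
    dualVolume G (polarBody K) = ∫ u, G (supportFn K u)⁻¹ u ∂(sphericalMeasure n) := by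
  simp only [dualVolume, radialFn_polarBody (supportFn_pos hK _)]

lemma ClassGI.continuous_inv_supportFn (hG : ClassGI G) (hK : K ∈ bodiesAroundZero n) :
    Continuous fun u => G (supportFn K u)⁻¹ u :=
  hG.continuous_comp ((continuous_supportFn_right K).inv₀ fun u => (supportFn_pos hK u).ne')
    fun u => inv_pos.2 (supportFn_pos hK u)

lemma ClassGI.continuousOn_dualVolume_polarBody (hG : ClassGI G) :
    ContinuousOn (fun K : ConvexBody (Space n) => dualVolume G (polarBody K))
      (bodiesAroundZero n) :=
  (hG.continuousOn_integral (f := fun (K : ConvexBody (Space n)) u => (supportFn K u)⁻¹)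
    (continuous_supportFn.continuousOn.inv₀ fun p hp => (supportFn_pos hp.1 p.2).ne')
    fun _ hK u => inv_pos.2 (supportFn_pos hK u)).congr fun _ hK => dualVolume_polarBody G hK

end Functionals

/-! ### Lower bounds on the support function -/

section PolarCoordinates

open Module ENNReal

variable {E : Type*} [NormedAddCommGroup E] [NormedSpace ℝ E] [FiniteDimensional ℝ E]
  [Nontrivial E] [MeasurableSpace E] [BorelSpace E] {μ : Measure E} [μ.IsAddHaarMeasure]

lemma lintegral_eq_lintegral_toSphere {f : E → ℝ≥0∞} (hf : Measurable f) :
    ∫⁻ x, f x ∂μ = ∫⁻ u, (∫⁻ r in Ioi (0 : ℝ),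
      .ofReal (r ^ (finrank ℝ E - 1)) * f (r • (u : E))) ∂μ.toSphere := by
  have hprod : Measurable fun p : Metric.sphere (0 : E) 1 × Ioi (0 : ℝ) => f ((p.2 : ℝ) • p.1) := by
    fun_prop
  calc ∫⁻ x, f x ∂μ
      = ∫⁻ x : ({0}ᶜ : Set E), f x ∂(μ.comap (↑)) := by
        rw [lintegral_subtype_comap (measurableSet_singleton _).compl, restrict_compl_singleton]
    _ = ∫⁻ p, f ((p.2 : ℝ) • (p.1 : E))
          ∂(μ.toSphere.prod (Measure.volumeIoiPow (finrank ℝ E - 1))) := by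
        rw [← μ.measurePreserving_homeomorphUnitSphereProd.lintegral_comp hprod]
        refine lintegral_congr fun x => congrArg f ?_
        simp [smul_smul, mul_inv_cancel₀ (norm_ne_zero_iff.2 x.2)]
    _ = ∫⁻ u, (∫⁻ r, f ((r : ℝ) • (u : E)) ∂(Measure.volumeIoiPow (finrank ℝ E - 1)))
          ∂μ.toSphere := lintegral_prod _ hprod.aemeasurable
    _ = _ := by
        refine lintegral_congr fun u => ?_
        rw [Measure.volumeIoiPow, lintegral_withDensity_eq_lintegral_mul _ (by fun_prop)
          (by fun_prop)]
        exact lintegral_subtype_comap measurableSet_Ioi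
          fun r : ℝ => ENNReal.ofReal (r ^ (finrank ℝ E - 1)) * f (r • (u : E))

end PolarCoordinates

section InnerRadius

variable {n m : ℕ} {K : ConvexBody (Space n)}

lemma pow_mul_inv_le_pow_pred {d : ℕ} {r ρ : ℝ} (hm : m ≠ 0) (hd : d ≤ m) (h1 : 1 ≤ r)
    (hr : r ≤ ρ) : r ^ d * r⁻¹ ≤ ρ ^ (m - 1) :=
  calc r ^ d * r⁻¹ ≤ r ^ m * r⁻¹ := by gcongr
    _ = r ^ (m - 1) := by
      rw [← div_eq_mul_inv, div_eq_iff (by positivity), pow_sub_one_mul hm]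
    _ ≤ ρ ^ (m - 1) := by gcongr

lemma lintegral_polarBody_inv_norm_le [Nontrivial (Space n)] (hK : K ∈ bodiesAroundZero n)
    (hm : m ≠ 0) (hn : n - 1 ≤ m) :
    ∫⁻ x in polarBody (K : Set (Space n)) \ Metric.ball 0 1, ENNReal.ofReal ‖x‖⁻¹ ≤
      ∫⁻ u, ENNReal.ofReal ((supportFn K u)⁻¹ ^ m) ∂(sphericalMeasure n) := by
  have hS : MeasurableSet (polarBody (K : Set (Space n)) \ Metric.ball 0 1) :=
    (isClosed_polarBody _).measurableSet.diff measurableSet_ball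
  rw [← lintegral_indicator hS, lintegral_eq_lintegral_toSphere (.indicator (by fun_prop) hS)]
  refine lintegral_mono fun u => ?_
  set ρ := (supportFn K u)⁻¹ with hρ
  have hρ0 : 0 < ρ := inv_pos.2 (supportFn_pos hK u)
  have hray : ∀ r ∈ Ioi (0 : ℝ),
      ENNReal.ofReal (r ^ (Module.finrank ℝ (Space n) - 1)) *
          (polarBody (K : Set (Space n)) \ Metric.ball 0 1).indicator
            (fun x => ENNReal.ofReal ‖x‖⁻¹) (r • (u : Space n)) ≤
        (Icc 0 ρ).indicator (fun _ => ENNReal.ofReal (ρ ^ (m - 1))) r := by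
    intro r (hr : 0 < r)
    by_cases hru : r • (u : Space n) ∈ polarBody (K : Set (Space n)) \ Metric.ball 0 1
    · have hnorm : ‖r • (u : Space n)‖ = r := by
        rw [norm_smul, norm_eq_of_mem_sphere, mul_one, Real.norm_of_nonneg hr.le]
      have h1 : 1 ≤ r := by simpa [hnorm] using hru.2
      have hrρ : r ≤ ρ := by
        rw [hρ, ← one_div, le_div_iff₀ (supportFn_pos hK u)]
        exact (smul_mem_polarBody_iff hr.le).1 hru.1
      rw [indicator_of_mem hru, indicator_of_mem (mem_Icc.2 ⟨hr.le, hrρ⟩), hnorm,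
        finrank_euclideanSpace_fin, ← ENNReal.ofReal_mul (by positivity)]
      exact ENNReal.ofReal_le_ofReal (pow_mul_inv_le_pow_pred hm hn h1 hrρ)
    · rw [indicator_of_notMem hru, mul_zero]
      exact zero_le
  calc _ ≤ ∫⁻ r in Ioi (0 : ℝ), (Icc 0 ρ).indicator (fun _ => ENNReal.ofReal (ρ ^ (m - 1))) r :=
        setLIntegral_mono' measurableSet_Ioi hray
    _ ≤ ∫⁻ r, (Icc 0 ρ).indicator (fun _ => ENNReal.ofReal (ρ ^ (m - 1))) r :=
        setLIntegral_le_lintegral _ _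
    _ = ENNReal.ofReal (ρ ^ m) := by
        rw [lintegral_indicator_const measurableSet_Icc, Real.volume_Icc, sub_zero,
          ← ENNReal.ofReal_mul (by positivity), pow_sub_one_mul hm]

lemma ball_smul_subset_polarBody_diff_ball {v : USphere n} {R s t : ℝ}
    (hKR : (K : Set (Space n)) ⊆ Metric.closedBall 0 R) (hs : s ≤ 1 / 2) (hsR : s * R ≤ 1 / 2)
    (ht : 2 ≤ t) (hv : t * supportFn K v ≤ 1 / 2) :
    Metric.ball (t • (v : Space n)) s ⊆ polarBody (K : Set (Space n)) \ Metric.ball 0 1 := by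
  intro x hx
  have hxs : ‖x - t • (v : Space n)‖ < s := by rwa [← dist_eq_norm]
  constructor
  · intro y hy
    calc inner ℝ x y
        = t * inner ℝ y (v : Space n) + inner ℝ (x - t • (v : Space n)) y := by
          rw [inner_sub_left, real_inner_smul_left, real_inner_comm (v : Space n) y,
            add_sub_cancel]
      _ ≤ t * supportFn K v + s * R := by
          gcongr
          · exact inner_le_supportFn hy v
          · exact (real_inner_le_norm _ _).trans
              (mul_le_mul hxs.le (by simpa using hKR hy) (norm_nonneg _)
                ((norm_nonneg _).trans hxs.le))
      _ ≤ 1 := by linarith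
  · have htri := norm_sub_norm_le (t • (v : Space n)) x
    rw [norm_smul, norm_eq_of_mem_sphere, mul_one, Real.norm_of_nonneg (by linarith),
      norm_sub_rev] at htri
    rw [mem_ball_zero_iff, not_lt]
    linarith

lemma norm_le_of_mem_ball_smul {v : USphere n} {s t : ℝ} (ht : 0 ≤ t) {x : Space n}
    (hx : x ∈ Metric.ball (t • (v : Space n)) s) : ‖x‖ ≤ t + s := by
  have htri := norm_le_norm_add_norm_sub' x (t • (v : Space n))
  rw [norm_smul, norm_eq_of_mem_sphere, mul_one, Real.norm_of_nonneg ht, ← dist_eq_norm] at htri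
  linarith [Metric.mem_ball.1 hx]

lemma pairwise_disjoint_ball_natCast_smul {v : USphere n} {s : ℝ} (hs : s ≤ 1 / 2) :
    Pairwise fun j k : ℕ => Disjoint (Metric.ball ((j + 2 : ℝ) • (v : Space n)) s)
      (Metric.ball ((k + 2 : ℝ) • (v : Space n)) s) := by
  intro j k hjk
  refine Metric.ball_disjoint_ball ?_
  rw [dist_eq_norm, ← sub_smul, norm_smul, norm_eq_of_mem_sphere, mul_one, add_sub_add_right_eq_sub]
  have hdist : (1 : ℝ) ≤ ‖(j : ℝ) - k‖ := Nat.pairwise_one_le_dist hjk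
  linarith

lemma sum_one_div_succ_le_lintegral_inv_supportFn_pow (hK : K ∈ bodiesAroundZero n)
    (hm : m ≠ 0) (hn : n - 1 ≤ m) {R s : ℝ}
    (hKR : (K : Set (Space n)) ⊆ Metric.closedBall 0 R) (hs : s ≤ 1 / 2) (hsR : s * R ≤ 1 / 2)
    {v : USphere n} {N : ℕ} (hv : (N + 1) * supportFn K v ≤ 1 / 2) :
    volume (Metric.ball (0 : Space n) s) *
        ENNReal.ofReal (1 / 3 * ∑ k ∈ Finset.range N, 1 / ((k : ℝ) + 1)) ≤
      ∫⁻ u, ENNReal.ofReal ((supportFn K u)⁻¹ ^ m) ∂(sphericalMeasure n) := by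
  have : Nontrivial (Space n) := ⟨v, 0, ne_zero_of_mem_unit_sphere v⟩
  let ball (k : ℕ) : Set (Space n) := Metric.ball ((k + 2 : ℝ) • (v : Space n)) s
  have hsub : ∀ k ∈ Finset.range N,
      ball k ⊆ polarBody (K : Set (Space n)) \ Metric.ball 0 1 := by
    refine fun k hk => ball_smul_subset_polarBody_diff_ball hKR hs hsR
      (by linarith [k.cast_nonneg (α := ℝ)]) (le_trans ?_ hv)
    have hkN : (k : ℝ) + 1 ≤ N := by exact_mod_cast Finset.mem_range.1 hk
    exact mul_le_mul_of_nonneg_right (by linarith) (supportFn_pos hK v).le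
  have hball : ∀ k ∈ Finset.range N, volume (Metric.ball (0 : Space n) s) *
      ENNReal.ofReal (1 / 3 * (1 / ((k : ℝ) + 1))) ≤ ∫⁻ x in ball k, ENNReal.ofReal ‖x‖⁻¹ := by
    intro k hk
    rw [← Measure.addHaar_ball_center volume ((k + 2 : ℝ) • (v : Space n)), mul_comm,
      ← setLIntegral_const]
    refine setLIntegral_mono' measurableSet_ball fun x hx => ENNReal.ofReal_le_ofReal ?_
    have hx1 : 1 ≤ ‖x‖ := by simpa using (hsub k hk hx).2
    rw [← one_div, one_div_mul_one_div]
    exact one_div_le_one_div_of_le (one_pos.trans_le hx1) <|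
      (norm_le_of_mem_ball_smul (by positivity) hx).trans (by linarith [k.cast_nonneg (α := ℝ)])
  calc _ = ∑ k ∈ Finset.range N, volume (Metric.ball (0 : Space n) s) *
        ENNReal.ofReal (1 / 3 * (1 / ((k : ℝ) + 1))) := by
        rw [Finset.mul_sum, ENNReal.ofReal_sum_of_nonneg (fun k _ => by positivity),
          Finset.mul_sum]
    _ ≤ ∑ k ∈ Finset.range N, ∫⁻ x in ball k, ENNReal.ofReal ‖x‖⁻¹ := Finset.sum_le_sum hball
    _ = ∫⁻ x in ⋃ k ∈ Finset.range N, ball k, ENNReal.ofReal ‖x‖⁻¹ :=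
        (lintegral_biUnion_finset ((pairwise_disjoint_ball_natCast_smul hs).set_pairwise _)
          (fun _ _ => measurableSet_ball) _).symm
    _ ≤ ∫⁻ x in polarBody (K : Set (Space n)) \ Metric.ball 0 1, ENNReal.ofReal ‖x‖⁻¹ :=
        lintegral_mono_set (iUnion₂_subset hsub)
    _ ≤ _ := lintegral_polarBody_inv_norm_le hK hm hn

lemma exists_forall_le_supportFn_of_lintegral_le (hm : m ≠ 0) (hn : n - 1 ≤ m) (R : ℝ)
    {C : ENNReal} (hC : C ≠ ⊤) : ∃ r > 0, ∀ K ∈ bodiesAroundZero n,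
      (K : Set (Space n)) ⊆ Metric.closedBall 0 R →
      ∫⁻ u, ENNReal.ofReal ((supportFn K u)⁻¹ ^ m) ∂(sphericalMeasure n) ≤ C →
      ∀ v : USphere n, r ≤ supportFn K v := by
  obtain ⟨s, hs0, hs, hsR⟩ : ∃ s : ℝ, 0 < s ∧ s ≤ 1 / 2 ∧ s * R ≤ 1 / 2 := by
    refine ⟨1 / (2 * (1 + |R|)), by positivity, ?_, ?_⟩
    · exact one_div_le_one_div_of_le two_pos (by linarith [abs_nonneg R])
    · rw [one_div_mul_eq_div, div_le_div_iff₀ (by positivity) two_pos]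
      linarith [le_abs_self R]
  have hharmonic : Tendsto (fun N => volume (Metric.ball (0 : Space n) s) *
      ENNReal.ofReal (1 / 3 * ∑ k ∈ Finset.range N, 1 / ((k : ℝ) + 1))) atTop (𝓝 ⊤) := by
    have htop := ENNReal.tendsto_ofReal_atTop.comp
      (Real.tendsto_sum_range_one_div_nat_succ_atTop.const_mul_atTop (one_div_pos.2 three_pos))
    have hpos := (Metric.measure_ball_pos volume (0 : Space n) hs0).ne'
    rw [← ENNReal.mul_top hpos]
    exact ENNReal.Tendsto.const_mul htop (.inl ENNReal.top_ne_zero)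
  obtain ⟨N, hN⟩ := (hharmonic.eventually_const_lt hC.lt_top).exists
  refine ⟨1 / (2 * (N + 1)), by positivity, fun K hK hKR hKC v => ?_⟩
  by_contra! hv
  rw [lt_div_iff₀ (by positivity)] at hv
  exact (hN.trans_le (sum_one_div_succ_le_lintegral_inv_supportFn_pow hK hm hn hKR hs hsR
    (v := v) (by linarith))).not_ge hKC

/-- The lower bound `G(t, u) ≥ c t^max(1, n - 1)` for large `t`. The exponent makes the dual volume
of `K°` large when `K` is bounded and its boundary is close to the origin. -/
def HasPowerGrowth (G : ℝ → USphere n → ℝ) : Prop :=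
  ∃ c > 0, ∃ T > 0, ∀ t ≥ T, ∀ u, c * t ^ max 1 (n - 1) ≤ G t u

variable {G : ℝ → USphere n → ℝ}

lemma HasPowerGrowth.exists_lintegral_inv_supportFn_pow_le (hG : ClassGI G)
    (hgrowth : HasPowerGrowth G) (C : ℝ) : ∃ B : ENNReal, B ≠ ⊤ ∧ ∀ K ∈ bodiesAroundZero n,
      dualVolume G (polarBody (K : Set (Space n))) ≤ C →
      ∫⁻ u, ENNReal.ofReal ((supportFn K u)⁻¹ ^ max 1 (n - 1)) ∂(sphericalMeasure n) ≤ B := by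
  obtain ⟨c, hc, T, hT, hbound⟩ := hgrowth
  set m := max 1 (n - 1)
  have hpow : ∀ t > 0, ∀ u, t ^ m ≤ T ^ m + c⁻¹ * G t u := by
    intro t ht u
    rcases le_total t T with htT | hTt
    · exact (pow_le_pow_left₀ ht.le htT m).trans <| le_add_of_nonneg_right <|
        mul_nonneg (inv_nonneg.2 hc.le) (hG.pos t ht u).le
    · exact ((le_inv_mul_iff₀ hc).2 (hbound t hTt u)).trans (le_add_of_nonneg_left (by positivity))
  refine ⟨ENNReal.ofReal (∫ _, T ^ m ∂(sphericalMeasure n) + c⁻¹ * C), ENNReal.ofReal_ne_top,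
    fun K hK hKC => ?_⟩
  have hGK := (integrable_of_continuous (μ := sphericalMeasure n)
    (hG.continuous_inv_supportFn hK)).const_mul c⁻¹
  calc ∫⁻ u, ENNReal.ofReal ((supportFn K u)⁻¹ ^ m) ∂(sphericalMeasure n)
      ≤ ∫⁻ u, ENNReal.ofReal (T ^ m + c⁻¹ * G (supportFn K u)⁻¹ u) ∂(sphericalMeasure n) :=
        lintegral_mono fun u =>
          ENNReal.ofReal_le_ofReal (hpow _ (inv_pos.2 (supportFn_pos hK u)) u)
    _ = ENNReal.ofReal (∫ u, (T ^ m + c⁻¹ * G (supportFn K u)⁻¹ u) ∂(sphericalMeasure n)) :=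
        (ofReal_integral_eq_lintegral_ofReal ((integrable_const _).add hGK) <| .of_forall fun u =>
          (pow_nonneg (inv_pos.2 (supportFn_pos hK u)).le m).trans
            (hpow _ (inv_pos.2 (supportFn_pos hK u)) u)).symm
    _ ≤ ENNReal.ofReal (∫ _, T ^ m ∂(sphericalMeasure n) + c⁻¹ * C) := by
        rw [integral_add (integrable_const _) hGK, integral_const_mul, ← dualVolume_polarBody G hK]
        gcongr

lemma HasPowerGrowth.exists_forall_le_supportFn (hG : ClassGI G) (hgrowth : HasPowerGrowth G)
    (R C : ℝ) : ∃ r > 0, ∀ K ∈ bodiesAroundZero n, (K : Set (Space n)) ⊆ Metric.closedBall 0 R →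
      dualVolume G (polarBody (K : Set (Space n))) ≤ C → ∀ v : USphere n, r ≤ supportFn K v := by
  obtain ⟨B, hB, hBC⟩ := hgrowth.exists_lintegral_inv_supportFn_pow_le hG C
  obtain ⟨r, hr, hrK⟩ := exists_forall_le_supportFn_of_lintegral_le (m := max 1 (n - 1))
    (by omega) (le_max_right _ _) R hB
  exact ⟨r, hr, fun K hK hKR hKC => hrK K hK hKR (hBC K hK hKC)⟩

end InnerRadius

/-! ### Convexity and growth -/

lemma mul_le_mul_of_convexOn_Ioi {f : ℝ → ℝ} (hf : ConvexOn ℝ (Ioi 0) f)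
    (h0 : Tendsto f (𝓝[>] 0) (𝓝 0)) {s t : ℝ} (hs : 0 < s) (hst : s ≤ t) :
    t * f s ≤ s * f t := by
  rcases hst.eq_or_lt with rfl | hst
  · exact le_rfl
  have hlim : Tendsto (fun δ => (f s - f δ) / (s - δ)) (𝓝[>] 0) (𝓝 ((f s - 0) / (s - 0))) :=
    (tendsto_const_nhds.sub h0).div
      (tendsto_const_nhds.sub (tendsto_id.mono_left nhdsWithin_le_nhds)) (by simpa using hs.ne')
  have hslope : (f s - 0) / (s - 0) ≤ (f t - f s) / (t - s) := by
    refine le_of_tendsto hlim ?_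
    filter_upwards [Ioo_mem_nhdsGT hs] with δ hδ
    exact hf.slope_mono_adjacent hδ.1 (hs.trans hst) hδ.2 hst
  rw [sub_zero, sub_zero, div_le_div_iff₀ hs (sub_pos.2 hst)] at hslope
  linarith

section

variable {n : ℕ} {G : ℝ → USphere n → ℝ} {φ : ℝ → ℝ} {q : ℝ}

lemma ClassI.sub_one_le (hφ : ClassI φ) (hconv : ConvexOn ℝ (Ioi 0) φ) {t : ℝ} (ht : 0 < t) :
    t - 1 ≤ φ t := by
  rcases le_total t 1 with h | h
  · linarith [hφ.pos t ht]
  · have hlin := mul_le_mul_of_convexOn_Ioi hconv hφ.tendsto_zero one_pos h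
    rw [hφ.map_one] at hlin
    linarith

lemma GrowthCondition.exists_mul_rpow_le (hG : ClassGI G) (hGq : GrowthCondition G q) :
    ∃ c > 0, ∀ t ≥ 1, ∀ u, c * t ^ q ≤ G t u := by
  refine ⟨_, hGq, fun t ht u => ?_⟩
  have ht0 : 0 < t := one_pos.trans_le ht
  rw [← le_div_iff₀ (Real.rpow_pos_of_pos ht0 q)]
  refine csInf_le ⟨0, ?_⟩ ⟨t, u, ht, rfl⟩
  rintro _ ⟨s, w, hs, rfl⟩
  have hs0 : 0 < s := one_pos.trans_le hs
  exact div_nonneg (hG.pos s hs0 w).le (Real.rpow_nonneg hs0.le q)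

lemma ClassGI.exists_mul_le_of_convexOn (hG : ClassGI G)
    (hconv : ∀ u, ConvexOn ℝ (Ioi 0) (fun t => G t u)) :
    ∃ c > 0, ∀ t ≥ 1, ∀ u, c * t ≤ G t u := by
  obtain ⟨c, hc, hcG⟩ := isCompact_univ.exists_forall_le' (a := (0 : ℝ))
    (hG.continuous_comp continuous_const fun _ => one_pos).continuousOn
    fun u _ => hG.pos 1 one_pos u
  refine ⟨c, hc, fun t ht u => ?_⟩
  calc c * t ≤ G 1 u * t :=
        mul_le_mul_of_nonneg_right (hcG u (mem_univ u)) (zero_le_one.trans ht)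
    _ = t * G 1 u := mul_comm _ _
    _ ≤ 1 * G t u := mul_le_mul_of_convexOn_Ioi (hconv u) (hG.tendsto_zero u) one_pos ht
    _ = G t u := one_mul _

/-- In dimensions one and two the exponent `n - 1` is too small, but convexity alone already gives
linear growth. -/
lemma GrowthCondition.hasPowerGrowth (hG : ClassGI G)
    (hconv : ∀ u, ConvexOn ℝ (Ioi 0) (fun t => G t u)) (hq : (n : ℝ) - 1 ≤ q)
    (hGq : GrowthCondition G q) : HasPowerGrowth G := by
  rcases le_total (n - 1) 1 with hn | hn
  · obtain ⟨c, hc, hlin⟩ := hG.exists_mul_le_of_convexOn hconv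
    refine ⟨c, hc, 1, one_pos, ?_⟩
    simpa only [max_eq_left hn, pow_one] using hlin
  · obtain ⟨c, hc, hpow⟩ := hGq.exists_mul_rpow_le hG
    refine ⟨c, hc, 1, one_pos, fun t ht u => le_trans ?_ (hpow t ht u)⟩
    rw [max_eq_right hn, ← Real.rpow_natCast, Nat.cast_sub (by omega), Nat.cast_one]
    gcongr

/-! ### The admissible class -/

variable {K : ConvexBody (Space n)}

lemma mem_tildeB_iff : K ∈ tildeB G ↔ K ∈ bodiesAroundZero n ∧
    dualVolume G (polarBody (K : Set (Space n))) = ∫ u, G 1 u ∂(sphericalMeasure n) := by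
  rw [tildeB, dualVolume_closedBall]
  rfl

lemma tildeB_subset_bodiesAroundZero (G : ℝ → USphere n → ℝ) : tildeB G ⊆ bodiesAroundZero n :=
  fun _ hK => hK.1

lemma unitBall_mem_tildeB (G : ℝ → USphere n → ℝ) : unitBall n ∈ tildeB G := by
  have hball : unitBall n ∈ bodiesAroundZero n :=
    zero_mem_interior_iff.2 fun u => supportFn_unitBall u ▸ one_pos
  refine mem_tildeB_iff.2 ⟨hball, ?_⟩
  simp only [dualVolume_polarBody G hball, supportFn_unitBall, inv_one]

lemma orliczIntegral_unitBall (hφ : ClassI φ) (μ : FiniteMeasure (USphere n)) :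
    orliczIntegral φ μ (unitBall n) = μ.mass := by
  simp only [orliczIntegral, supportFn_unitBall, hφ.map_one, integral_const, smul_eq_mul, mul_one]
  rfl

lemma isSolution_iff (hφ : ClassI φ) {B : Set (ConvexBody (Space n))}
    (hB : B ⊆ bodiesAroundZero n) {μ : FiniteMeasure (USphere n)} {M : ConvexBody (Space n)} :
    IsSolution φ μ B M ↔ M ∈ B ∧ ∀ Q ∈ B, orliczIntegral φ μ M ≤ orliczIntegral φ μ Q := by
  refine and_congr_right fun hM => ⟨fun h Q hQ => ?_, fun h => ?_⟩
  · rw [h]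
    refine csInf_le ⟨0, ?_⟩ (mem_image_of_mem _ hQ)
    rintro _ ⟨K, hK, rfl⟩
    exact integral_nonneg fun u => (hφ.pos _ (supportFn_pos (hB hK) u)).le
  · exact (IsLeast.csInf_eq ⟨mem_image_of_mem _ hM, forall_mem_image.2 h⟩).symm

/-! ### Coercivity -/

lemma integral_max_inner_pos {μ : FiniteMeasure (USphere n)} (hμ : NotConcentratedOnHemisphere μ)
    (v : USphere n) :
    0 < ∫ u : USphere n, max (inner ℝ (v : Space n) (u : Space n)) 0
      ∂(μ : Measure (USphere n)) := by
  rw [integral_pos_iff_support_of_nonneg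
    (f := fun u : USphere n => max (inner ℝ (v : Space n) (u : Space n)) 0)
    (fun u => le_max_right _ _) (integrable_of_continuous (by fun_prop))]
  refine pos_iff_ne_zero.2 ?_
  convert hμ (-v) using 2
  ext u
  simp [inner_neg_right, real_inner_comm]

lemma exists_forall_mul_norm_le_integral_max_inner {μ₀ : FiniteMeasure (USphere n)}
    (hμ₀ : NotConcentratedOnHemisphere μ₀) :
    ∃ δ > 0, ∀ᶠ μ : FiniteMeasure (USphere n) in 𝓝 μ₀, ∀ x : Space n,
      δ * ‖x‖ ≤ ∫ u : USphere n, max (inner ℝ x (u : Space n)) 0 ∂(μ : Measure (USphere n)) := by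
  let F (μ : FiniteMeasure (USphere n)) (v : USphere n) : ℝ :=
    ∫ u : USphere n, max (inner ℝ (v : Space n) (u : Space n)) 0 ∂(μ : Measure (USphere n))
  have hF : Continuous fun p : FiniteMeasure (USphere n) × USphere n => F p.1 p.2 := by
    rw [← continuousOn_univ]
    exact continuousOn_integral continuousOn_fst (Continuous.continuousOn (by fun_prop))
  obtain ⟨c, hc, hcF⟩ := isCompact_univ.exists_forall_le' (f := F μ₀)
    (hF.comp (.prodMk_right μ₀)).continuousOn fun v _ => integral_max_inner_pos hμ₀ v
  have hev : ∀ᶠ μ in 𝓝 μ₀, ∀ v ∈ (univ : Set (USphere n)), c / 2 < F μ v :=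
    isCompact_univ.eventually_forall_of_forall_eventually fun v hv =>
      hF.continuousAt.eventually_const_lt ((half_lt_self hc).trans_le (hcF v hv))
  refine ⟨c / 2, half_pos hc, hev.mono fun μ hμ x => ?_⟩
  rcases eq_or_ne x 0 with rfl | hx
  · simp
  obtain ⟨v, hv⟩ := exists_norm_smul_eq hx
  have hhom (u : USphere n) : max (inner ℝ x (u : Space n)) 0 =
      ‖x‖ * max (inner ℝ (v : Space n) (u : Space n)) 0 := by
    rw [mul_max_of_nonneg _ _ (norm_nonneg x), mul_zero, ← real_inner_smul_left, hv]
  simp only [hhom]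
  rw [integral_const_mul, mul_comm]
  exact mul_le_mul_of_nonneg_left (hμ v (mem_univ v)).le (norm_nonneg x)

lemma integral_max_inner_le (hφ : ClassI φ) (hφconv : ConvexOn ℝ (Ioi 0) φ)
    (μ : FiniteMeasure (USphere n)) (hK : K ∈ bodiesAroundZero n) {x : Space n} (hx : x ∈ K) :
    ∫ u : USphere n, max (inner ℝ x (u : Space n)) 0 ∂(μ : Measure (USphere n)) ≤
      orliczIntegral φ μ K + μ.mass := by
  have hpoint (u : USphere n) :
      max (inner ℝ x (u : Space n)) 0 ≤ φ (supportFn K u) + 1 :=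
    (max_le (inner_le_supportFn hx u) (supportFn_pos hK u).le).trans
      (sub_le_iff_le_add.1 (hφ.sub_one_le hφconv (supportFn_pos hK u)))
  have hint := integrable_of_continuous (μ := (μ : Measure (USphere n)))
    (hφ.continuous_comp_supportFn hK)
  calc _ ≤ ∫ u, (φ (supportFn K u) + 1) ∂(μ : Measure (USphere n)) :=
        integral_mono (integrable_of_continuous (by fun_prop)) (hint.add (integrable_const 1))
          hpoint
    _ = _ := by
        rw [integral_add hint (integrable_const 1), integral_const, smul_eq_mul, mul_one]
        rfl

lemma exists_subset_closedBall_of_orliczIntegral_le (hφ : ClassI φ)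
    (hφconv : ConvexOn ℝ (Ioi 0) φ) {μ₀ : FiniteMeasure (USphere n)}
    (hμ₀ : NotConcentratedOnHemisphere μ₀) :
    ∃ R, ∀ᶠ μ in 𝓝 μ₀, ∀ K ∈ bodiesAroundZero n, orliczIntegral φ μ K ≤ μ.mass →
      (K : Set (Space n)) ⊆ Metric.closedBall 0 R := by
  obtain ⟨δ, hδ, hcoercive⟩ := exists_forall_mul_norm_le_integral_max_inner hμ₀
  have hmass : ∀ᶠ μ : FiniteMeasure (USphere n) in 𝓝 μ₀, (μ.mass : ℝ) < μ₀.mass + 1 :=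
    (NNReal.continuous_coe.comp FiniteMeasure.continuous_mass).continuousAt.eventually_lt_const
      (lt_add_one _)
  refine ⟨2 * (μ₀.mass + 1) / δ, ?_⟩
  filter_upwards [hcoercive, hmass] with μ hμ hμm K hK hobj x hx
  rw [mem_closedBall_zero_iff, le_div_iff₀' hδ]
  linarith [hμ x, integral_max_inner_le hφ hφconv μ hK hx]

/-! ### Existence of minimizers -/

lemma isCompact_tildeB_inter (hG : ClassGI G) {r : ℝ} (hr : 0 < r) (R : ℝ) :
    IsCompact (tildeB G ∩ {K : ConvexBody (Space n) |
      (K : Set (Space n)) ⊆ Metric.closedBall 0 R ∧ ∀ u : USphere n, r ≤ supportFn K u}) := by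
  let S : Set (ConvexBody (Space n)) := {K | ∀ u : USphere n, r ≤ supportFn K u}
  have hS : IsClosed S := by
    simp only [S, ofPred_forall]
    exact isClosed_iInter fun u => isClosed_le continuous_const
      (continuous_supportFn.comp (.prodMk_left u))
  have hSpos : S ⊆ bodiesAroundZero n := fun K hK =>
    zero_mem_interior_iff.2 fun u => hr.trans_le (hK u)
  have hlevel := (hG.continuousOn_dualVolume_polarBody.mono hSpos).preimage_isClosed_of_isClosed hS
    (isClosed_singleton (x := ∫ u, G 1 u ∂(sphericalMeasure n)))
  convert (isCompact_setOf_subset (isCompact_closedBall (0 : Space n) R)).inter_right hlevel using 1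
  ext K
  constructor
  · rintro ⟨hK, hKR, hKr⟩
    exact ⟨hKR, hKr, (mem_tildeB_iff.1 hK).2⟩
  · rintro ⟨hKR, hKr, hK⟩
    exact ⟨mem_tildeB_iff.2 ⟨hSpos hKr, hK⟩, hKR, hKr⟩

lemma exists_isCompact_forall_mem_of_orliczIntegral_le (hφ : ClassI φ)
    (hφconv : ConvexOn ℝ (Ioi 0) φ) (hG : ClassGI G) (hgrowth : HasPowerGrowth G)
    {μ₀ : FiniteMeasure (USphere n)} (hμ₀ : NotConcentratedOnHemisphere μ₀) :
    ∃ S ⊆ tildeB G, IsCompact S ∧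
      ∀ᶠ μ in 𝓝 μ₀, ∀ K ∈ tildeB G, orliczIntegral φ μ K ≤ μ.mass → K ∈ S := by
  obtain ⟨R, hR⟩ := exists_subset_closedBall_of_orliczIntegral_le hφ hφconv hμ₀
  obtain ⟨r, hr, hrK⟩ := hgrowth.exists_forall_le_supportFn hG R
    (∫ u, G 1 u ∂(sphericalMeasure n))
  refine ⟨_, inter_subset_left, isCompact_tildeB_inter hG hr R, hR.mono fun μ hμ K hK hobj => ?_⟩
  obtain ⟨hK0, hvol⟩ := mem_tildeB_iff.1 hK
  exact ⟨hK, hμ K hK0 hobj, hrK K hK0 (hμ K hK0 hobj) hvol.le⟩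

lemma exists_isSolution (hφ : ClassI φ) (hφconv : ConvexOn ℝ (Ioi 0) φ) (hG : ClassGI G)
    (hgrowth : HasPowerGrowth G) {μ : FiniteMeasure (USphere n)}
    (hμ : NotConcentratedOnHemisphere μ) : ∃ M, IsSolution φ μ (tildeB G) M := by
  obtain ⟨S, hSB, hS, hev⟩ :=
    exists_isCompact_forall_mem_of_orliczIntegral_le hφ hφconv hG hgrowth hμ
  have hunit : unitBall n ∈ S :=
    hev.self_of_nhds _ (unitBall_mem_tildeB G) (orliczIntegral_unitBall hφ μ).le
  have hcont : ContinuousOn (orliczIntegral φ μ) S :=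
    hφ.continuousOn_orliczIntegral.comp (Continuous.prodMk_right μ).continuousOn
      fun K hK => ⟨mem_univ _, (hSB hK).1⟩
  obtain ⟨M, hM, hmin⟩ := hS.exists_isMinOn ⟨_, hunit⟩ hcont
  refine ⟨M, (isSolution_iff hφ (tildeB_subset_bodiesAroundZero G)).2 ⟨hSB hM, fun Q hQ => ?_⟩⟩
  rcases le_total (orliczIntegral φ μ Q) μ.mass with h | h
  · exact hmin (hev.self_of_nhds Q hQ h)
  · exact (hmin hunit).trans ((orliczIntegral_unitBall hφ μ).trans_le h)

end

variable {n : ℕ} {G : ℝ → USphere n → ℝ} {φ : ℝ → ℝ} {K L : ConvexBody (Space n)}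

/-! ### Scaling the argument of the dual volume -/

section Scaling

variable {f : USphere n → ℝ}

lemma ClassGI.continuous_comp_div (hG : ClassGI G) (hf : Continuous f) (hpos : ∀ u, 0 < f u)
    {η : ℝ} (hη : 0 < η) : Continuous fun u => G (f u / η) u :=
  hG.continuous_comp (hf.div_const η) fun u => div_pos (hpos u) hη

lemma ClassGI.continuousOn_integral_div (hG : ClassGI G) (hf : Continuous f)
    (hpos : ∀ u, 0 < f u) :
    ContinuousOn (fun η => ∫ u, G (f u / η) u ∂(sphericalMeasure n)) (Ioi 0) :=
  hG.continuousOn_integral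
    ((hf.comp continuous_snd).continuousOn.div continuousOn_fst fun _ hp => (mem_Ioi.1 hp.1).ne')
    fun _ hη u => div_pos (hpos u) hη

lemma ClassGI.strictAntiOn_integral_div [Nonempty (USphere n)] (hG : ClassGI G)
    (hf : Continuous f) (hpos : ∀ u, 0 < f u) :
    StrictAntiOn (fun η => ∫ u, G (f u / η) u ∂(sphericalMeasure n)) (Ioi 0) := by
  intro s (hs : 0 < s) t (ht : 0 < t) hst
  have hlt (u : USphere n) : G (f u / t) u < G (f u / s) u :=
    hG.strictMonoOn u (div_pos (hpos u) ht) (div_pos (hpos u) hs)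
      (div_lt_div_of_pos_left (hpos u) hs hst)
  exact integral_lt_integral_of_le_of_lt (hG.continuous_comp_div hf hpos ht)
    (hG.continuous_comp_div hf hpos hs) (fun u => (hlt u).le) (hlt (Classical.arbitrary _))

lemma ClassGI.integral_pos [Nonempty (USphere n)] (hG : ClassGI G) (hf : Continuous f)
    (hpos : ∀ u, 0 < f u) : 0 < ∫ u, G (f u) u ∂(sphericalMeasure n) := by
  have hGpos (u : USphere n) : 0 < G (f u) u := hG.pos _ (hpos u) u
  exact (hG.continuous_comp hf hpos).integral_pos_of_hasCompactSupport_nonneg_nonzero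
    (.of_compactSpace _) (fun u => (hGpos u).le) (hGpos (Classical.arbitrary _)).ne'

lemma ClassGI.mul_integral_div_le (hG : ClassGI G)
    (hconv : ∀ u, ConvexOn ℝ (Ioi 0) (fun t => G t u)) (hf : Continuous f) (hpos : ∀ u, 0 < f u)
    {s t : ℝ} (hs : 0 < s) (hst : s ≤ t) :
    t * ∫ u, G (f u / t) u ∂(sphericalMeasure n) ≤
      s * ∫ u, G (f u / s) u ∂(sphericalMeasure n) := by
  have ht := hs.trans_le hst
  have hpoint (u : USphere n) : t * G (f u / t) u ≤ s * G (f u / s) u := by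
    have h := mul_le_mul_of_convexOn_Ioi (hconv u) (hG.tendsto_zero u) (div_pos (hpos u) ht)
      (div_le_div_of_nonneg_left (hpos u).le hs hst)
    rw [div_mul_eq_mul_div, div_mul_eq_mul_div, div_le_div_iff₀ hs ht, mul_assoc, mul_assoc] at h
    linarith [le_of_mul_le_mul_left h (hpos u)]
  rw [← integral_const_mul, ← integral_const_mul]
  exact integral_mono
    ((integrable_of_continuous (hG.continuous_comp_div hf hpos ht)).const_mul t)
    ((integrable_of_continuous (hG.continuous_comp_div hf hpos hs)).const_mul s) hpoint

lemma ClassGI.exists_integral_div_eq [Nonempty (USphere n)] (hG : ClassGI G)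
    (hconv : ∀ u, ConvexOn ℝ (Ioi 0) (fun t => G t u)) (hf : Continuous f) (hpos : ∀ u, 0 < f u)
    {w : ℝ} (hw : 0 < w) : ∃ η > 0, ∫ u, G (f u / η) u ∂(sphericalMeasure n) = w := by
  set V : ℝ → ℝ := fun η => ∫ u, G (f u / η) u ∂(sphericalMeasure n) with hV
  have hV1 : 0 < V 1 := by simpa only [hV, div_one] using hG.integral_pos hf hpos
  set a := min 1 (V 1 / w)
  set b := max 1 (V 1 / w)
  have ha0 : 0 < a := lt_min one_pos (div_pos hV1 hw)
  have hVa : w ≤ V a := by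
    have haV : a * w ≤ V 1 := (le_div_iff₀ hw).1 (min_le_right _ _)
    have := hG.mul_integral_div_le hconv hf hpos ha0 (min_le_left 1 _)
    exact le_of_mul_le_mul_left (by linarith) ha0
  have hVb : V b ≤ w := by
    have hbV : V 1 ≤ b * w := (div_le_iff₀ hw).1 (le_max_right _ _)
    have := hG.mul_integral_div_le hconv hf hpos one_pos (le_max_left 1 (V 1 / w))
    exact le_of_mul_le_mul_left (by linarith) (ha0.trans_le min_le_max)
  obtain ⟨η, hη, hVη⟩ := intermediate_value_Icc' min_le_max
    ((hG.continuousOn_integral_div hf hpos).mono fun η hη => ha0.trans_le hη.1) ⟨hVb, hVa⟩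
  exact ⟨η, ha0.trans_le hη.1, hVη⟩

end Scaling

/-! ### Uniqueness of minimizers -/

lemma exists_smul_mem_tildeB [Nonempty (USphere n)] (hG : ClassGI G)
    (hconv : ∀ u, ConvexOn ℝ (Ioi 0) (fun t => G t u)) (hK : K ∈ bodiesAroundZero n)
    (hlt : dualVolume G (polarBody (K : Set (Space n))) < ∫ u, G 1 u ∂(sphericalMeasure n)) :
    ∃ c : ℝ, 0 < c ∧ c < 1 ∧ c • K ∈ tildeB G := by
  have hf : Continuous fun u : USphere n => (supportFn K u)⁻¹ :=
    (continuous_supportFn_right K).inv₀ fun u => (supportFn_pos hK u).ne'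
  have hpos (u : USphere n) : 0 < (supportFn K u)⁻¹ := inv_pos.2 (supportFn_pos hK u)
  obtain ⟨c, hc, hcV⟩ := hG.exists_integral_div_eq hconv hf hpos
    (hG.integral_pos continuous_const fun _ => one_pos)
  have hcK := smul_mem_bodiesAroundZero hc hK
  refine ⟨c, hc, ?_, mem_tildeB_iff.2 ⟨hcK, ?_⟩⟩
  · refine ((hG.strictAntiOn_integral_div hf hpos).lt_iff_gt (mem_Ioi.2 one_pos) hc).1 ?_
    simpa only [hcV, div_one, dualVolume_polarBody G hK] using hlt
  · simp only [dualVolume_polarBody G hcK, supportFn_smul hc.le, mul_inv_rev, ← div_eq_mul_inv, hcV]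

lemma strictConvexOn_comp_inv {f : ℝ → ℝ} (hf : ConvexOn ℝ (Ioi 0) f)
    (hmono : StrictMonoOn f (Ioi 0)) : StrictConvexOn ℝ (Ioi 0) fun t => f t⁻¹ := by
  have himage : Inv.inv '' Ioi (0 : ℝ) = Ioi 0 := by
    simp only [image_inv_eq_inv, Set.ext_iff, Set.mem_inv, mem_Ioi, inv_pos, implies_true]
  have hinv : StrictConvexOn ℝ (Ioi (0 : ℝ)) Inv.inv := by
    simpa using strictConvexOn_zpow (m := -1) (by norm_num) (by norm_num)
  exact (himage.symm ▸ hf).comp_strictConvexOn hinv (himage.symm ▸ hmono)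

lemma dualVolume_polarBody_midpoint_lt (hG : ClassGI G)
    (hconv : ∀ u, ConvexOn ℝ (Ioi 0) (fun t => G t u)) (hK : K ∈ bodiesAroundZero n)
    (hL : L ∈ bodiesAroundZero n) (hne : K ≠ L) :
    dualVolume G (polarBody ((2⁻¹ : ℝ) • (K + L) : ConvexBody (Space n))) <
      2⁻¹ * dualVolume G (polarBody (K : Set (Space n))) +
        2⁻¹ * dualVolume G (polarBody (L : Set (Space n))) := by
  have hM := midpoint_mem_bodiesAroundZero hK hL
  have hGinv (u : USphere n) : StrictConvexOn ℝ (Ioi 0) fun t => G t⁻¹ u :=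
    strictConvexOn_comp_inv (hconv u) (hG.strictMonoOn u)
  obtain ⟨u, hu⟩ : ∃ u : USphere n, supportFn K u ≠ supportFn L u := by
    by_contra! h
    exact hne (eq_of_forall_supportFn_eq h)
  have hcK := (hG.continuous_inv_supportFn hK).const_mul 2⁻¹
  have hcL := (hG.continuous_inv_supportFn hL).const_mul 2⁻¹
  rw [dualVolume_polarBody G hM, dualVolume_polarBody G hK, dualVolume_polarBody G hL,
    ← integral_const_mul, ← integral_const_mul,
    ← integral_add (integrable_of_continuous hcK) (integrable_of_continuous hcL)]
  refine integral_lt_integral_of_le_of_lt (hG.continuous_inv_supportFn hM) (hcK.add hcL)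
    (fun v => ?_) (y := u) ?_
  · simpa only [supportFn_midpoint, smul_eq_mul] using (hGinv v).convexOn.2 (supportFn_pos hK v)
      (supportFn_pos hL v) (by norm_num) (by norm_num) (by norm_num)
  · simpa only [supportFn_midpoint, smul_eq_mul] using (hGinv u).2 (supportFn_pos hK u)
      (supportFn_pos hL u) hu (by norm_num) (by norm_num) (by norm_num)

lemma orliczIntegral_midpoint_le (hφ : ClassI φ) (hφconv : ConvexOn ℝ (Ioi 0) φ)
    (μ : FiniteMeasure (USphere n)) (hK : K ∈ bodiesAroundZero n) (hL : L ∈ bodiesAroundZero n) :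
    orliczIntegral φ μ ((2⁻¹ : ℝ) • (K + L)) ≤
      2⁻¹ * orliczIntegral φ μ K + 2⁻¹ * orliczIntegral φ μ L := by
  have hcK := (hφ.continuous_comp_supportFn hK).const_mul 2⁻¹
  have hcL := (hφ.continuous_comp_supportFn hL).const_mul 2⁻¹
  rw [orliczIntegral, orliczIntegral, orliczIntegral, ← integral_const_mul, ← integral_const_mul,
    ← integral_add (integrable_of_continuous hcK) (integrable_of_continuous hcL)]
  refine integral_mono (integrable_of_continuous
    (hφ.continuous_comp_supportFn (midpoint_mem_bodiesAroundZero hK hL)))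
    (integrable_of_continuous (hcK.add hcL)) fun u => ?_
  simpa only [supportFn_midpoint, smul_eq_mul] using hφconv.2 (supportFn_pos hK u)
    (supportFn_pos hL u) (by norm_num) (by norm_num) (by norm_num)

lemma orliczIntegral_smul_lt (hφ : ClassI φ) {μ : FiniteMeasure (USphere n)} (hμ : μ ≠ 0)
    (hK : K ∈ bodiesAroundZero n) {c : ℝ} (hc0 : 0 < c) (hc1 : c < 1) :
    orliczIntegral φ μ (c • K) < orliczIntegral φ μ K := by
  have hcK := smul_mem_bodiesAroundZero hc0 hK
  refine integral_lt_integral_of_forall_lt (μ := (μ : Measure (USphere n)))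
    (fun h => hμ (Subtype.ext h)) (hφ.continuous_comp_supportFn hcK)
    (hφ.continuous_comp_supportFn hK) fun u => ?_
  refine hφ.strictMonoOn (supportFn_pos hcK u) (supportFn_pos hK u) ?_
  rw [supportFn_smul hc0.le]
  exact mul_lt_of_lt_one_left (supportFn_pos hK u) hc1

lemma IsSolution.eq [Nonempty (USphere n)] (hφ : ClassI φ) (hφconv : ConvexOn ℝ (Ioi 0) φ)
    (hG : ClassGI G) (hconv : ∀ u, ConvexOn ℝ (Ioi 0) (fun t => G t u))
    {μ : FiniteMeasure (USphere n)} (hμ : μ ≠ 0) (hK : IsSolution φ μ (tildeB G) K)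
    (hL : IsSolution φ μ (tildeB G) L) : K = L := by
  by_contra hne
  rw [isSolution_iff hφ (tildeB_subset_bodiesAroundZero G)] at hK hL
  obtain ⟨hK0, hKV⟩ := mem_tildeB_iff.1 hK.1
  obtain ⟨hL0, hLV⟩ := mem_tildeB_iff.1 hL.1
  have hM0 := midpoint_mem_bodiesAroundZero hK0 hL0
  have hlt := dualVolume_polarBody_midpoint_lt hG hconv hK0 hL0 hne
  obtain ⟨c, hc0, hc1, hcM⟩ := exists_smul_mem_tildeB hG hconv hM0 (by linarith)
  linarith [orliczIntegral_smul_lt hφ hμ hM0 hc0 hc1,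
    orliczIntegral_midpoint_le hφ hφconv μ hK0 hL0, hK.2 _ hcM, hL.2 _ hcM]

lemma NotConcentratedOnHemisphere.ne_zero [Nonempty (USphere n)] {μ : FiniteMeasure (USphere n)}
    (hμ : NotConcentratedOnHemisphere μ) : μ ≠ 0 := by
  rintro rfl
  exact hμ (Classical.arbitrary _) (by simp)

lemma existsUnique_isSolution [Nonempty (USphere n)] (hφ : ClassI φ)
    (hφconv : ConvexOn ℝ (Ioi 0) φ) (hG : ClassGI G)
    (hconv : ∀ u, ConvexOn ℝ (Ioi 0) (fun t => G t u)) (hgrowth : HasPowerGrowth G)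
    {μ : FiniteMeasure (USphere n)} (hμ : NotConcentratedOnHemisphere μ) :
    ∃! M, IsSolution φ μ (tildeB G) M :=
  existsUnique_of_exists_of_unique (exists_isSolution hφ hφconv hG hgrowth hμ)
    fun _ _ => IsSolution.eq hφ hφconv hG hconv hμ.ne_zero

/-! ### Stability of minimizers -/

lemma tendsto_of_isSolution [Nonempty (USphere n)] (hφ : ClassI φ)
    (hφconv : ConvexOn ℝ (Ioi 0) φ) (hG : ClassGI G)
    (hconv : ∀ u, ConvexOn ℝ (Ioi 0) (fun t => G t u)) (hgrowth : HasPowerGrowth G)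
    {ι : Type*} {l : Filter ι} {μ : ι → FiniteMeasure (USphere n)}
    {μ₀ : FiniteMeasure (USphere n)} (hμ₀ : NotConcentratedOnHemisphere μ₀)
    (hlim : Tendsto μ l (𝓝 μ₀)) {M : ι → ConvexBody (Space n)} {M₀ : ConvexBody (Space n)}
    (hM : ∀ i, IsSolution φ (μ i) (tildeB G) (M i)) (hM₀ : IsSolution φ μ₀ (tildeB G) M₀) :
    Tendsto M l (𝓝 M₀) := by
  have hsol {ν : FiniteMeasure (USphere n)} {K : ConvexBody (Space n)} :=
    isSolution_iff (μ := ν) (M := K) hφ (tildeB_subset_bodiesAroundZero G)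
  obtain ⟨S, hSB, hS, hev⟩ :=
    exists_isCompact_forall_mem_of_orliczIntegral_le hφ hφconv hG hgrowth hμ₀
  have hMS : ∀ᶠ i in l, M i ∈ S := (hlim.eventually hev).mono fun i hi => hi _ (hM i).1 <|
    ((hsol.1 (hM i)).2 _ (unitBall_mem_tildeB G)).trans_eq (orliczIntegral_unitBall hφ (μ i))
  refine hS.tendsto_nhds_of_unique_mapClusterPt hMS fun N hN hcluster => ?_
  obtain ⟨F, hFl, hFN⟩ := mapClusterPt_iff_ultrafilter.1 hcluster
  have hcont {K : ConvexBody (Space n)} {Q : ι → ConvexBody (Space n)}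
      (hK : K ∈ bodiesAroundZero n) (hQ : ∀ i, Q i ∈ bodiesAroundZero n)
      (hQK : Tendsto Q F (𝓝 K)) :
      Tendsto (fun i => orliczIntegral φ (μ i) (Q i)) F (𝓝 (orliczIntegral φ μ₀ K)) :=
    (hφ.continuousOn_orliczIntegral (μ₀, K) ⟨mem_univ _, hK⟩).tendsto.comp <|
      tendsto_nhdsWithin_iff.2 ⟨(hlim.mono_left hFl).prodMk_nhds hQK,
        .of_forall fun i => ⟨mem_univ _, hQ i⟩⟩
  have hle : orliczIntegral φ μ₀ N ≤ orliczIntegral φ μ₀ M₀ :=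
    le_of_tendsto_of_tendsto' (hcont (hSB hN).1 (fun i => (hM i).1.1) hFN)
      (hcont hM₀.1.1 (fun _ => hM₀.1.1) tendsto_const_nhds) fun i => (hsol.1 (hM i)).2 M₀ hM₀.1
  exact IsSolution.eq hφ hφconv hG hconv hμ₀.ne_zero
    (hsol.2 ⟨hSB hN, fun Q hQ => hle.trans ((hsol.1 hM₀).2 Q hQ)⟩) hM₀

/-! ### The homogeneous general dual volume -/

/-- The function `(t, u) ↦ G (t / a) u`. For a suitable `a > 0` it turns the constraint on the
homogeneous general dual volume of `G` into one on a general dual volume. -/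
def rescale (G : ℝ → USphere n → ℝ) (a : ℝ) : ℝ → USphere n → ℝ := fun t u => G (t / a) u

lemma ClassGI.rescale (hG : ClassGI G) {a : ℝ} (ha : 0 < a) : ClassGI (rescale G a) where
  continuousOn := hG.continuousOn.comp
    (f := fun p : ℝ × USphere n => (p.1 / a, p.2)) (by fun_prop)
    fun _ hp => ⟨div_pos hp.1 ha, mem_univ _⟩
  pos _ ht := hG.pos _ (div_pos ht ha)
  strictMonoOn u _ hs _ ht hst := hG.strictMonoOn u (div_pos hs ha) (div_pos ht ha)
    (div_lt_div_of_pos_right hst ha)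
  tendsto_zero u := by
    have hdiv : Tendsto (fun t : ℝ => t / a) (𝓝[>] 0) (𝓝 0) := by
      simpa only [id, zero_div] using
        ((continuous_id.div_const a).tendsto (0 : ℝ)).mono_left nhdsWithin_le_nhds
    exact (hG.tendsto_zero u).comp <| tendsto_nhdsWithin_iff.2
      ⟨hdiv, eventually_mem_nhdsWithin.mono fun t ht => div_pos ht ha⟩
  tendsto_atTop u := (hG.tendsto_atTop u).comp (tendsto_id.atTop_div_const ha)

lemma convexOn_rescale {a : ℝ} (ha : 0 < a) {u : USphere n}
    (h : ConvexOn ℝ (Ioi 0) (fun t => G t u)) :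
    ConvexOn ℝ (Ioi 0) (fun t => rescale G a t u) := by
  refine ⟨convex_Ioi 0, fun s hs t ht b c hb hc hbc => ?_⟩
  have hdiv : (b * s + c * t) / a = b * (s / a) + c * (t / a) := by ring
  simpa only [rescale, smul_eq_mul, hdiv] using h.2 (div_pos hs ha) (div_pos ht ha) hb hc hbc

lemma HasPowerGrowth.rescale (h : HasPowerGrowth G) {a : ℝ} (ha : 0 < a) :
    HasPowerGrowth (rescale G a) := by
  obtain ⟨c, hc, T, hT, h⟩ := h
  refine ⟨c / a ^ max 1 (n - 1), by positivity, T * a, by positivity, fun t ht u => ?_⟩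
  simpa only [DualPolar.rescale, div_pow, mul_div_assoc', div_mul_eq_mul_div] using
    h (t / a) ((le_div_iff₀ ha).2 ht) u

lemma ClassGI.sInf_eq_iff [Nonempty (USphere n)] {f : USphere n → ℝ} (hG : ClassGI G)
    (hconv : ∀ u, ConvexOn ℝ (Ioi 0) (fun t => G t u)) (hf : Continuous f)
    (hpos : ∀ u, 0 < f u) {a : ℝ} :
    sInf {η : ℝ | 0 < η ∧ ∫ u, G (f u / η) u ∂(sphericalMeasure n) ≤ 1} = a ↔
      0 < a ∧ ∫ u, G (f u / a) u ∂(sphericalMeasure n) = 1 := by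
  have hsInf {b : ℝ} (hb : 0 < b) (hVb : ∫ u, G (f u / b) u ∂(sphericalMeasure n) = 1) :
      sInf {η : ℝ | 0 < η ∧ ∫ u, G (f u / η) u ∂(sphericalMeasure n) ≤ 1} = b := by
    refine IsLeast.csInf_eq ⟨⟨hb, hVb.le⟩, fun η hη => ?_⟩
    exact ((hG.strictAntiOn_integral_div hf hpos).le_iff_ge hη.1 hb).1 (hη.2.trans_eq hVb.symm)
  refine ⟨?_, fun h => hsInf h.1 h.2⟩
  obtain ⟨b, hb, hVb⟩ := hG.exists_integral_div_eq hconv hf hpos one_pos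
  rintro rfl
  rw [hsInf hb hVb]
  exact ⟨hb, hVb⟩

lemma ClassGI.hatB_eq_tildeB_rescale [Nonempty (USphere n)] (hG : ClassGI G)
    (hconv : ∀ u, ConvexOn ℝ (Ioi 0) (fun t => G t u)) :
    ∃ a > 0, hatB G = tildeB (DualPolar.rescale G a) := by
  set a := homDualVolume G (Metric.closedBall (0 : Space n) 1) with ha
  have hball := ha.symm
  simp only [homDualVolume, radialFn_closedBall] at hball
  obtain ⟨ha0, ha1⟩ := (hG.sInf_eq_iff hconv continuous_const fun _ => one_pos).1 hball
  refine ⟨a, ha0, Set.ext fun K => ?_⟩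
  rw [mem_tildeB_iff]
  refine and_congr_right fun hK => ?_
  rw [dualVolume_polarBody _ hK, ← ha]
  simp only [homDualVolume, radialFn_polarBody (supportFn_pos hK _), DualPolar.rescale, ha1]
  rw [hG.sInf_eq_iff (f := fun u => (supportFn (K : Set (Space n)) u)⁻¹) hconv
    ((continuous_supportFn_right K).inv₀ fun u => (supportFn_pos hK u).ne')
    fun u => inv_pos.2 (supportFn_pos hK u)]
  exact and_iff_right ha0

end

end DualPolar

/-- Existence, uniqueness and continuous dependence on the measure (weak convergence of measures,
Hausdorff convergence of bodies) of the minimizers, for both normalizations. -/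
theorem mainTheorem2 (n : ℕ)
    (μ : ℕ → FiniteMeasure (DualPolar.USphere n)) (μ₀ : FiniteMeasure (DualPolar.USphere n))
    (hμ : ∀ i, μ i ≠ 0) (hμ₀ : μ₀ ≠ 0)
    (hμH : ∀ i, DualPolar.NotConcentratedOnHemisphere (μ i))
    (hμ₀H : DualPolar.NotConcentratedOnHemisphere μ₀)
    (hlim : Tendsto μ atTop (𝓝 μ₀))
    (G : ℝ → DualPolar.USphere n → ℝ) (hG : DualPolar.ClassGI G)
    (hGconv : ∀ u, ConvexOn ℝ (Ioi 0) (fun t => G t u))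
    (hGgrowth : ∃ q : ℝ, (n : ℝ) - 1 ≤ q ∧ DualPolar.GrowthCondition G q)
    (φ : ℝ → ℝ) (hφ : DualPolar.ClassI φ) (hφconv : ConvexOn ℝ (Ioi 0) φ) :
    ((∃! M, DualPolar.IsSolution φ μ₀ (DualPolar.tildeB G) M) ∧
      (∀ i, ∃! M, DualPolar.IsSolution φ (μ i) (DualPolar.tildeB G) M) ∧
      ∀ (M : ℕ → ConvexBody (DualPolar.Space n)) (M₀ : ConvexBody (DualPolar.Space n)),
        (∀ i, DualPolar.IsSolution φ (μ i) (DualPolar.tildeB G) (M i)) →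
        DualPolar.IsSolution φ μ₀ (DualPolar.tildeB G) M₀ →
        Tendsto M atTop (𝓝 M₀)) ∧
    ((∃! M, DualPolar.IsSolution φ μ₀ (DualPolar.hatB G) M) ∧
      (∀ i, ∃! M, DualPolar.IsSolution φ (μ i) (DualPolar.hatB G) M) ∧
      ∀ (M : ℕ → ConvexBody (DualPolar.Space n)) (M₀ : ConvexBody (DualPolar.Space n)),
        (∀ i, DualPolar.IsSolution φ (μ i) (DualPolar.hatB G) (M i)) →
        DualPolar.IsSolution φ μ₀ (DualPolar.hatB G) M₀ →
        Tendsto M atTop (𝓝 M₀)) := by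
  obtain ⟨q, hq, hGq⟩ := hGgrowth
  have : Nonempty (DualPolar.USphere n) := by
    by_contra! hempty
    exact hμ₀ (Subtype.ext (Measure.eq_zero_of_isEmpty _))
  have hgrowth := hGq.hasPowerGrowth hG hGconv hq
  have wellPosed {H : ℝ → DualPolar.USphere n → ℝ} (hH : DualPolar.ClassGI H)
      (hHconv : ∀ u, ConvexOn ℝ (Ioi 0) (fun t => H t u)) (hHgrowth : DualPolar.HasPowerGrowth H) :
      (∃! M, DualPolar.IsSolution φ μ₀ (DualPolar.tildeB H) M) ∧
      (∀ i, ∃! M, DualPolar.IsSolution φ (μ i) (DualPolar.tildeB H) M) ∧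
      ∀ (M : ℕ → ConvexBody (DualPolar.Space n)) (M₀ : ConvexBody (DualPolar.Space n)),
        (∀ i, DualPolar.IsSolution φ (μ i) (DualPolar.tildeB H) (M i)) →
        DualPolar.IsSolution φ μ₀ (DualPolar.tildeB H) M₀ → Tendsto M atTop (𝓝 M₀) :=
    ⟨DualPolar.existsUnique_isSolution hφ hφconv hH hHconv hHgrowth hμ₀H,
      fun i => DualPolar.existsUnique_isSolution hφ hφconv hH hHconv hHgrowth (hμH i),
      fun _ _ => DualPolar.tendsto_of_isSolution hφ hφconv hH hHconv hHgrowth hμ₀H hlim⟩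
  refine ⟨wellPosed hG hGconv hgrowth, ?_⟩
  obtain ⟨a, ha, hhat⟩ := hG.hatB_eq_tildeB_rescale hGconv
  rw [hhat]
  exact wellPosed (hG.rescale ha) (fun u => DualPolar.convexOn_rescale ha (hGconv u))
    (hgrowth.rescale ha)
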